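/- Let $E$ be a finite set and let $\{\mathbb P_x\}_{x\in E}$ be a continuous-time Markov chain on $E$ with jump rates $q(x,y)\ge 0$ $(x\ne y)$, viewed as a family of laws on the space of piecewise constant càdlàg paths $\omega:[0,\infty)\to E$, with coordinate maps $X_t(\omega)=\omega(t)$. For a probability measure $\lambda$ on $E$ put $\mathbb P_\lambda=\sum_x\lambda(x)\mathbb P_x$. Assume that the chain is mixing: it has a unique stationary distribution $\pi$, and for every $\alpha\in(0,1)$ there is $T\ge 0$ such that the total variation distance between $\pi$ and the law of $X_T$ under $\mathbb P_x$ is at most $\alpha$ for all $x\in E$; let $T_{\rm mix}(\alpha)$ be the smallest such $T$. For $B\subset E$ let $H_B=\inf\{t\ge 0: X_t\in B\}$. For $m>0$, $\alpha>0$ and $\beta\in(0,1)$, say that an almost surely finite non-negative random variable $Z$ is $\mathrm{Exp}(m,\alpha,\beta)$ if for all $t>0$ $$(1-\alpha)\,e^{-\frac{t}{(1-\beta)m}}\le \Pr(Z\ge t)\le (1+\alpha)\,e^{-\frac{t}{(1+\beta)m}}.$$ **Theorem.** There are universal constants $C,c>0$ with the following property. Let the chain be as above, let $A=\bigcup_{i=1}^{\ell}A_i\subset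 E$ with $\pi(A)>0$, where $A_1,\dots,A_\ell$ are non-empty and have the same mean hitting time from stationarity, $$m:=\mathbb E_\pi[H_{A_1}]=\dots=\mathbb E_\pi[H_{A_\ell}],$$ and let $0<\delta<1/5$ and $0<\varepsilon<\delta/(2\ell)$ be such that $$\mathbb P_\pi\big(H_{A_i}\le T_{\rm mix}(\delta\varepsilon/2)\big)\le \frac{\delta\varepsilon}{2}\qquad\text{for all }1\le i\le \ell .$$ Put $$\xi=\frac1{\ell\varepsilon}\sum_{1\le i<j\le \ell}\mathbb P_\pi\big(H_{A_i}\le\varepsilon m,\ H_{A_j}\le \varepsilon m\big).$$ If $\delta+\xi\le c$, then for every probability measure $\lambda$ on $E$ there are real numbers $a,b$ with $|a|\le C\,\ell\varepsilon$ and $|b|\le C(\delta+\xi)$ such that, under $\mathbb P_\lambda$, $H_A$ is $$\mathrm{Exp}\Big(\frac m\ell,\ 2r_\lambda+a,\ b\Big),\qquad\text{where } r_\lambda=\mathbb P_\lambda\big(H_A\le T_{\rm mix}(\delta\varepsilon)\big).$$ In short, $H_A$ is $\mathrm{Exp}(m/\ell,\,2r_\lambda+O(\ell\varepsilon),\,O(\delta+\xi))$.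 -/

import Mathlib

open Filter Topology MeasureTheory
open scoped NNReal ENNReal

noncomputable section

namespace RareEvents

/-- `ω` is a step path: for some `0 = t₀ < t₁ < ⋯` tending to infinity, `ω` is constant on
each interval `[tₙ, tₙ₊₁)`. -/
def IsStepPath {V : Type*} (ω : ℝ≥0 → V) : Prop :=
  ∃ t : ℕ → ℝ≥0, t 0 = 0 ∧ StrictMono t ∧ Tendsto t atTop atTop ∧
    ∀ n, ∀ s ∈ Set.Ico (t n) (t (n + 1)), ω s = ω (t n)

/-- The path space `𝔻([0, ∞), V)`. -/
def Path (V : Type*) : Type _ := {ω : ℝ≥0 → V // IsStepPath ω}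

/-- The coordinate projection `X_t`. -/
def X {V : Type*} (t : ℝ≥0) (ω : Path V) : V := ω.1 t

/-- The σ-field on path space generated by all the projections `X_t` (every subset of the
finite state space being measurable). -/
instance {V : Type*} : MeasurableSpace (Path V) :=
  ⨆ t : ℝ≥0, MeasurableSpace.comap (X t) ⊤

/-- The σ-field `F_T` generated by `X_s`, `0 ≤ s ≤ T`. -/
@[reducible] def pastSigma (V : Type*) (T : ℝ≥0) : MeasurableSpace (Path V) :=
  ⨆ s : {s : ℝ≥0 // s ≤ T}, MeasurableSpace.comap (X s.1) ⊤

theorem isStepPath_shift {V : Type*} {ω : ℝ≥0 → V} (h : IsStepPath ω) (T : ℝ≥0) :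
    IsStepPath (fun s => ω (s + T)) := by
  obtain ⟨t, t0, tm, tt, tc⟩ := h
  have hex : ∃ n, T < t n := (tt.eventually_gt_atTop T).exists
  obtain ⟨N, hN1, hN2⟩ : ∃ N, t N ≤ T ∧ T < t (N + 1) := by
    classical
    have hpos : Nat.find hex ≠ 0 := fun h0 => by
      have := Nat.find_spec hex
      rw [h0, t0] at this
      exact absurd this (not_lt.2 (zero_le))
    obtain ⟨N, hN⟩ := Nat.exists_eq_succ_of_ne_zero hpos
    refine ⟨N, not_lt.1 (Nat.find_min hex (by omega)), ?_⟩
    have := Nat.find_spec hex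
    rwa [hN] at this
  have hle : ∀ n, T < t (N + 1 + n) := fun n => hN2.trans_le (tm.monotone (by omega))
  refine ⟨fun n => t (N + n) - T, tsub_eq_zero_of_le hN1, ?_, ?_, ?_⟩
  · refine strictMono_nat_of_lt_succ fun n => ?_
    have h1 : t (N + n) < t (N + (n + 1)) := tm (by omega)
    have h2 : T < t (N + (n + 1)) := by
      have := hle n
      rwa [show N + 1 + n = N + (n + 1) by omega] at this
    change t (N + n) - T < t (N + (n + 1)) - T
    rcases le_total T (t (N + n)) with h | h
    · exact tsub_lt_tsub_right_of_le h h1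
    · rw [tsub_eq_zero_of_le h]
      exact tsub_pos_of_lt h2
  · refine tendsto_atTop.2 fun b => ?_
    filter_upwards [((tendsto_add_atTop_iff_nat N).2 tt).eventually_ge_atTop (b + T)] with n hn
    rw [add_comm N n]
    exact le_tsub_of_add_le_right hn
  · intro n s hs
    obtain ⟨hs1, hs2⟩ := hs
    have h3 : s + T < t (N + n + 1) := lt_tsub_iff_right.1 hs2
    have h4 : t (N + n) ≤ s + T := tsub_le_iff_right.1 hs1
    have e1 : ω (s + T) = ω (t (N + n)) := tc _ _ ⟨h4, h3⟩
    have e2 : ω (t (N + n) - T + T) = ω (t (N + n)) := by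
      refine tc _ _ ⟨le_tsub_add, ?_⟩
      exact lt_of_le_of_lt (by gcongr) h3
    exact e1.trans e2.symm

/-- The time shift `Θ_T`. -/
def shift {V : Type*} (T : ℝ≥0) (ω : Path V) : Path V :=
  ⟨fun s => ω.1 (s + T), isStepPath_shift ω.2 T⟩

/-- `P` is the continuous-time Markov chain with jump rates `q x y` (`x ≠ y`): the family of
laws on path space started from each state. The third condition says that the conditional law
of `X ∘ Θ_T` given `F_T` under `P x` is `P (X_T)`. -/
structure IsMarkovChain {V : Type*} (q : V → V → ℝ) (P : V → Measure (Path V)) : Prop where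
  isProb : ∀ x, IsProbabilityMeasure (P x)
  start : ∀ x, P x {ω | X 0 ω = x} = 1
  rate : ∀ x y, x ≠ y →
    Tendsto (fun s : ℝ≥0 => (P x).real {ω | X s ω = y} / (s : ℝ)) (𝓝[>] 0) (𝓝 (q x y))
  markov : ∀ (x : V) (T : ℝ≥0) (B S : Set (Path V)),
    MeasurableSet[pastSigma V T] B → MeasurableSet S →
      P x (B ∩ shift T ⁻¹' S) = ∫⁻ ω in B, P (X T ω) S ∂(P x)

section

variable {V : Type*} [Fintype V]

/-- The law `P_μ` of the chain started from the distribution `μ`. -/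
def startedFrom (P : V → Measure (Path V)) (μ : PMF V) : Measure (Path V) :=
  ∑ x, μ x • P x

/-- `μ` is stationary: under `P_μ`, `X ∘ Θ_T` has the same law as `X`. -/
def IsStationary (P : V → Measure (Path V)) (μ : PMF V) : Prop :=
  ∀ (T : ℝ≥0) (S : Set (Path V)), MeasurableSet S →
    startedFrom P μ (shift T ⁻¹' S) = startedFrom P μ S

/-- Total variation distance of two mass functions on a finite set. -/
def tvDist (p p' : V → ℝ) : ℝ := (1 / 2) * ∑ s, |p s - p' s|

/-- At time `T`, from every starting state, the chain is within `α` of `π` in total variation. -/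
def MixedAt (P : V → Measure (Path V)) (π : PMF V) (α : ℝ) (T : ℝ≥0) : Prop :=
  ∀ x, tvDist (fun s => (P x).real {ω | X T ω = s}) (fun s => (π s).toReal) ≤ α

/-- The chain is mixing, with unique stationary distribution `π`. -/
structure IsMixing (P : V → Measure (Path V)) (π : PMF V) : Prop where
  stationary : IsStationary P π
  unique : ∀ μ : PMF V, IsStationary P μ → μ = π
  mixed : ∀ α : ℝ, 0 < α → α < 1 → ∃ T, MixedAt P π α T

/-- The `α`-mixing time. -/
def mixingTime (P : V → Measure (Path V)) (π : PMF V) (α : ℝ) : ℝ≥0 :=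
  sInf {T | MixedAt P π α T}

end

/-- The hitting time `H_A = inf {t ≥ 0 : ω(t) ∈ A}`, equal to `∞` if `A` is never hit. -/
def hittingTime {V : Type*} (A : Set V) (ω : Path V) : ℝ≥0∞ :=
  ⨅ t ∈ {t : ℝ≥0 | X t ω ∈ A}, (t : ℝ≥0∞)

/-- Under `P`, the random time `Z` is almost surely finite and its law is `Exp(m, α, β)`. -/
structure IsNearExp {Ω : Type*} [MeasurableSpace Ω] (P : Measure Ω) (Z : Ω → ℝ≥0∞)
    (m α β : ℝ) : Prop where
  mean_pos : 0 < m
  alpha_pos : 0 < α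
  beta_pos : 0 < β
  beta_lt_one : β < 1
  aemeasurable : AEMeasurable Z P
  finite : ∀ᵐ ω ∂P, Z ω ≠ ∞
  lower : ∀ t : ℝ, 0 < t →
    (1 - α) * Real.exp (-t / ((1 - β) * m)) ≤ P.real {ω | ENNReal.ofReal t ≤ Z ω}
  upper : ∀ t : ℝ, 0 < t →
    P.real {ω | ENNReal.ofReal t ≤ Z ω} ≤ (1 + α) * Real.exp (-t / ((1 + β) * m))

/-- The correlation term
`ξ = (1 / (ℓ ε)) ∑_{i < j} P_π (H_{A_i} ≤ ε m, H_{A_j} ≤ ε m)`. -/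
def pairCorrelation {V : Type*} [Fintype V] (P : V → Measure (Path V)) (π : PMF V) {l : ℕ}
    (A : Fin l → Set V) (m : ℝ≥0∞) (ε : ℝ) : ℝ :=
  (1 / (l * ε)) * ∑ p : Fin l × Fin l with p.1 < p.2,
    (startedFrom P π).real
      {ω | hittingTime (A p.1) ω ≤ ENNReal.ofReal ε * m ∧
        hittingTime (A p.2) ω ≤ ENNReal.ofReal ε * m}

end RareEvents

end

noncomputable section

namespace RareEvents

/-! ### Step paths, hitting events and their measurability. -/

section Paths

variable {V : Type*}

/-! Put `s = ε m`, write `κ` for the mixing error, `T` for the mixing time, and `g t` for the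
probability of avoiding a set `B` up to time `t`. Mixing makes `g` almost geometric along multiples
of `s`, with ratio governed by the stationary probability `p` that `B` is hit by time `s`. Waiting
for mixing in each period gives `g (k s) ≤ θ ^ k` with `θ` slightly above `1 - p`. Conversely, each
further period multiplies survival by at least a factor slightly below `1 - p`, once the initial
period `T` has been survived (`real_compl_hitBy_add_ge`, `pow_le_real_compl_hitBy`).

This is used twice. For `B = A i`, started from `π`, summing the geometric bounds shows that the
mean is about `s / p`; as the mean is `m`, `p = ε (1 + O(δ))` (`real_hitBy_mul_mean_mem_Icc`). The
union bound and the second Bonferroni inequality then give the stationary probability `l ε (1 + O(δ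
+ ξ))` of hitting the union by time `s`. For the union, started from any `μ`, the same geometric
bounds turn into exponentials of mean `s / (l ε) = m / l` (`isNearExp_hittingTime`). The initial law
enters only through the chance of a hit before mixing. -/

theorem pastSigma_le (T : ℝ≥0) : pastSigma V T ≤ (inferInstance : MeasurableSpace (Path V)) :=
  iSup_le fun s => le_iSup (fun t : ℝ≥0 => MeasurableSpace.comap (X (V := V) t) ⊤) s.1

theorem measurableSet_past_X {T t : ℝ≥0} (h : t ≤ T) (B : Set V) :
    MeasurableSet[pastSigma V T] {ω | X t ω ∈ B} :=
  le_iSup (fun s : {s : ℝ≥0 // s ≤ T} => MeasurableSpace.comap (X (V := V) s.1) ⊤) ⟨t, h⟩ _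
    ⟨B, trivial, rfl⟩

theorem measurableSet_X (t : ℝ≥0) (B : Set V) : MeasurableSet {ω : Path V | X t ω ∈ B} :=
  pastSigma_le t _ (measurableSet_past_X le_rfl B)

theorem measurable_shift (T : ℝ≥0) : Measurable (shift (V := V) T) := by
  refine measurable_iff_comap_le.2 ?_
  conv_lhs => rw [instMeasurableSpacePath, MeasurableSpace.comap_iSup]
  refine iSup_le fun t => ?_
  rw [MeasurableSpace.comap_comp]
  exact le_iSup (fun t : ℝ≥0 => MeasurableSpace.comap (X (V := V) t) ⊤) (t + T)

/-- Paths are locally constant to the right of each time. -/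
theorem exists_const_right (ω : Path V) (t : ℝ≥0) :
    ∃ u > t, ∀ s ∈ Set.Ico t u, X s ω = X t ω := by
  obtain ⟨τ, τ0, τm, -, τc⟩ := isStepPath_shift ω.2 t
  have h1 : 0 < τ 1 := τ0 ▸ τm Nat.zero_lt_one
  refine ⟨t + τ 1, lt_add_of_pos_right t h1, fun s hs => ?_⟩
  have h2 := τc 0 (s - t) ⟨by simp [τ0], by
    rw [zero_add]; exact (tsub_lt_iff_left hs.1).2 hs.2⟩
  simp only [τ0, zero_add, tsub_add_cancel_of_le hs.1] at h2
  exact h2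

/-- The event that `B` is visited during `[0, t]`. -/
def hitBy (B : Set V) (t : ℝ≥0) : Set (Path V) := {ω | ∃ s ≤ t, X s ω ∈ B}

theorem hitBy_mono (B : Set V) {t u : ℝ≥0} (h : t ≤ u) : hitBy B t ⊆ hitBy B u :=
  fun _ ⟨s, hs, hB⟩ => ⟨s, hs.trans h, hB⟩

theorem hittingTime_le_of_mem {B : Set V} {ω : Path V} {t : ℝ≥0} (h : X t ω ∈ B) :
    hittingTime B ω ≤ t :=
  iInf₂_le (f := fun (t : ℝ≥0) (_ : t ∈ {t : ℝ≥0 | X t ω ∈ B}) => (t : ℝ≥0∞)) t h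

/-- Right-constancy makes the infimum attained: a path that avoids `B` up to `t` avoids it a little
longer, so its hitting time exceeds `t` strictly. -/
theorem hittingTime_le_iff {B : Set V} {ω : Path V} {t : ℝ≥0} :
    hittingTime B ω ≤ t ↔ ω ∈ hitBy B t := by
  refine ⟨fun h => ?_, fun ⟨s, hs, hB⟩ => (hittingTime_le_of_mem hB).trans (by exact_mod_cast hs)⟩
  by_contra hn
  obtain ⟨u, hu, hc⟩ := exists_const_right ω t
  have hge : (u : ℝ≥0∞) ≤ hittingTime B ω := by
    refine le_iInf₂ fun s hs => ?_
    by_contra hlt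
    have hsu : s < u := by exact_mod_cast not_le.1 hlt
    rcases le_total s t with h1 | h1
    · exact hn ⟨s, h1, hs⟩
    · exact hn ⟨t, le_rfl, hc s ⟨h1, hsu⟩ ▸ hs⟩
  exact absurd (hge.trans h) (not_le.2 (by exact_mod_cast hu))

theorem setOf_hittingTime_le (B : Set V) (t : ℝ≥0) :
    {ω : Path V | hittingTime B ω ≤ t} = hitBy B t :=
  Set.ext fun _ => hittingTime_le_iff

theorem setOf_lt_hittingTime (B : Set V) (t : ℝ≥0) :
    {ω : Path V | (t : ℝ≥0∞) < hittingTime B ω} = (hitBy B t)ᶜ :=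
  Set.ext fun _ => not_le.symm.trans (not_congr hittingTime_le_iff)

/-- Right-constancy reduces the uncountable union over times to a countable dense set. The endpoint
`t` is treated separately, since looking to its right would leave the σ-field of the past. -/
theorem measurableSet_past_hitBy (B : Set V) (t : ℝ≥0) :
    MeasurableSet[pastSigma V t] (hitBy B t) := by
  obtain ⟨D, hDc, hDd⟩ := TopologicalSpace.exists_countable_dense ℝ≥0
  have : hitBy B t = {ω | X t ω ∈ B} ∪ ⋃ s ∈ D ∩ Set.Iio t, {ω | X s ω ∈ B} := by
    ext ω
    simp only [Set.mem_union, Set.mem_iUnion, Set.mem_ofPred_eq, exists_prop]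
    constructor
    · rintro ⟨s, hs, hB⟩
      rcases hs.eq_or_lt with rfl | hs
      · exact Or.inl hB
      · obtain ⟨u, hu, hc⟩ := exists_const_right ω s
        obtain ⟨d, hd, hd1, hd2⟩ := hDd.exists_between (lt_min hu hs)
        exact Or.inr ⟨d, ⟨hd, hd2.trans_le (min_le_right _ _)⟩,
          (hc d ⟨hd1.le, hd2.trans_le (min_le_left _ _)⟩).symm ▸ hB⟩
    · rintro (h | ⟨s, hs, hB⟩)
      · exact ⟨t, le_rfl, h⟩
      · exact ⟨s, le_of_lt hs.2, hB⟩
  rw [this]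
  exact (measurableSet_past_X le_rfl B).union
    (MeasurableSet.biUnion (hDc.mono Set.inter_subset_left) fun s hs =>
      measurableSet_past_X (le_of_lt hs.2) B)

theorem measurableSet_hitBy (B : Set V) (t : ℝ≥0) : MeasurableSet (hitBy B t) :=
  pastSigma_le t _ (measurableSet_past_hitBy B t)

theorem measurable_hittingTime (B : Set V) : Measurable (hittingTime B) := by
  refine measurable_of_Iic fun a => ?_
  induction a with
  | top => simp
  | coe a =>
    change MeasurableSet {ω | hittingTime B ω ≤ a}
    rw [setOf_hittingTime_le]
    exact measurableSet_hitBy B a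

theorem hitBy_add (B : Set V) (t s : ℝ≥0) :
    hitBy B (t + s) = hitBy B t ∪ shift t ⁻¹' hitBy B s := by
  ext ω
  constructor
  · rintro ⟨u, hu, hB⟩
    rcases le_total u t with h | h
    · exact Or.inl ⟨u, h, hB⟩
    · refine Or.inr ⟨u - t, tsub_le_iff_left.2 hu, ?_⟩
      change ω.1 (u - t + t) ∈ B
      rwa [tsub_add_cancel_of_le h]
  · rintro (⟨u, hu, hB⟩ | ⟨u, hu, hB⟩)
    · exact ⟨u, hu.trans le_self_add, hB⟩
    · exact ⟨u + t, by rw [add_comm t s]; gcongr, hB⟩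

theorem hitBy_iUnion {ι : Type*} (A : ι → Set V) (t : ℝ≥0) :
    hitBy (⋃ i, A i) t = ⋃ i, hitBy (A i) t := by
  ext ω
  simp only [hitBy, Set.mem_ofPred_eq, Set.mem_iUnion]
  constructor
  · rintro ⟨s, hs, i, hi⟩
    exact ⟨i, s, hs, hi⟩
  · rintro ⟨i, s, hs, hi⟩
    exact ⟨s, hs, i, hi⟩

/-- A time is at most `s` times the number of multiples `k s`, `k ≥ 0`, lying before it. -/
theorem le_tsum_indicator_multiples {s : ℝ≥0} (hs : 0 < s) (h : ℝ≥0∞) :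
    h ≤ ∑' k : ℕ, if ((k * s : ℝ≥0) : ℝ≥0∞) < h then (s : ℝ≥0∞) else 0 := by
  refine le_of_forall_lt fun a ha => ?_
  lift a to ℝ≥0 using ha.ne_top
  obtain ⟨n, hn⟩ : ∃ n : ℕ, n = ⌊a / s⌋₊ := ⟨_, rfl⟩
  have h1 : (n : ℝ≥0) * s ≤ a := by
    rw [← le_div_iff₀ hs, hn]; exact Nat.floor_le zero_le
  have h2 : a < (n + 1 : ℕ) * s := by
    rw [← div_lt_iff₀ hs, hn]; push_cast; exact Nat.lt_floor_add_one _
  refine lt_of_lt_of_le (b := (((n + 1 : ℕ) * s : ℝ≥0) : ℝ≥0∞)) (by exact_mod_cast h2) ?_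
  refine le_trans (le_of_eq ?_) (ENNReal.sum_le_tsum (Finset.range (n + 1)))
  rw [Finset.sum_congr rfl fun k hk => if_pos ?_]
  · simp
  · refine lt_of_le_of_lt ?_ ha
    have hk' : (k : ℝ≥0) ≤ n := by exact_mod_cast Nat.lt_succ_iff.1 (Finset.mem_range.1 hk)
    exact_mod_cast (mul_le_mul_of_nonneg_right hk' hs.le).trans h1

/-- A time is at least `s` times the number of multiples `(k + 1) s`, `k ≥ 0`, lying before it. -/
theorem tsum_indicator_multiples_le (s : ℝ≥0) (h : ℝ≥0∞) :
    ∑' k : ℕ, (if (((k + 1 : ℕ) * s : ℝ≥0) : ℝ≥0∞) < h then (s : ℝ≥0∞) else 0) ≤ h := by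
  refine ENNReal.tsum_le_of_sum_range_le fun n => ?_
  induction n with
  | zero => simp
  | succ n ih =>
    by_cases hn : (((n + 1 : ℕ) * s : ℝ≥0) : ℝ≥0∞) < h
    · refine le_trans (le_trans (Finset.sum_le_sum (g := fun _ => (s : ℝ≥0∞)) fun k _ => ?_)
        (le_of_eq ?_)) hn.le
      · split_ifs <;> simp
      · simp
    · rw [Finset.sum_range_succ, if_neg hn, add_zero]
      exact ih

end Paths

/-! ### Markov property, mixing, and geometric bounds on survival. -/

section Chain

theorem IsMarkovChain.tendsto_real_X {V : Type*} {q : V → V → ℝ}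
    {P : V → Measure (Path V)} (hP : IsMarkovChain q P) (x y : V) (t : ℝ≥0) :
    Tendsto (fun s => (P x).real {ω | X s ω = y}) (𝓝[≥] t) (𝓝 ((P x).real {ω | X t ω = y})) := by
  have := hP.isProb
  refine (ENNReal.tendsto_toReal (measure_ne_top _ _)).comp
    (tendsto_measure_of_tendsto_indicator_of_isFiniteMeasure _ _
      (fun s => measurableSet_X s {y}) fun ω => ?_)
  obtain ⟨u, hu, hc⟩ := exists_const_right ω t
  filter_upwards [Ico_mem_nhdsGE hu] with s hs
  rw [hc s hs]

variable {V : Type*} [Fintype V] {q : V → V → ℝ} {P : V → Measure (Path V)} {π : PMF V}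

theorem sum_toReal_pmf (μ : PMF V) : ∑ x, (μ x).toReal = 1 := by
  rw [← ENNReal.toReal_sum fun x _ => μ.apply_ne_top x, ← tsum_fintype (L := .unconditional _),
    μ.tsum_coe, ENNReal.toReal_one]

theorem startedFrom_apply (P : V → Measure (Path V)) (μ : PMF V) (S : Set (Path V)) :
    startedFrom P μ S = ∑ x, μ x * P x S := by
  simp [startedFrom, Measure.finsetSum_apply]

theorem IsMarkovChain.isProbabilityMeasure_startedFrom (hP : IsMarkovChain q P) (μ : PMF V) :
    IsProbabilityMeasure (startedFrom P μ) := by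
  have := hP.isProb
  refine ⟨?_⟩
  simp only [startedFrom_apply, measure_univ, mul_one]
  rw [← tsum_fintype (L := .unconditional _), μ.tsum_coe]

theorem IsMarkovChain.startedFrom_real (hP : IsMarkovChain q P) (μ : PMF V) (S : Set (Path V)) :
    (startedFrom P μ).real S = ∑ x, (μ x).toReal * (P x).real S := by
  have := hP.isProb
  rw [measureReal_def, startedFrom_apply, ENNReal.toReal_sum]
  · simp [measureReal_def]
  · exact fun x _ => ENNReal.mul_ne_top (μ.apply_ne_top x) (measure_ne_top _ _)

/-- If `S` has probability at most `c` from every state, then after time `t` it has conditional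
probability at most `c` given the past. -/
theorem IsMarkovChain.real_inter_shift_le (hP : IsMarkovChain q P) (μ : PMF V) {t : ℝ≥0}
    {B S : Set (Path V)} (hB : MeasurableSet[pastSigma V t] B) (hS : MeasurableSet S) {c : ℝ}
    (hc : ∀ x, (P x).real S ≤ c) :
    (startedFrom P μ).real (B ∩ shift t ⁻¹' S) ≤ (startedFrom P μ).real B * c := by
  have := hP.isProb
  rw [hP.startedFrom_real, hP.startedFrom_real, Finset.sum_mul]
  refine Finset.sum_le_sum fun x _ => ?_
  rw [mul_assoc]
  refine mul_le_mul_of_nonneg_left ?_ ENNReal.toReal_nonneg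
  have hc0 : 0 ≤ c := measureReal_nonneg.trans (hc x)
  have h1 : P x (B ∩ shift t ⁻¹' S) ≤ ENNReal.ofReal c * P x B := by
    rw [hP.markov x t B S hB hS, ← setLIntegral_const]
    refine lintegral_mono fun ω => ?_
    rw [← ofReal_measureReal]
    exact ENNReal.ofReal_le_ofReal (hc _)
  have h2 := ENNReal.toReal_mono (by finiteness) h1
  rwa [ENNReal.toReal_mul, ENNReal.toReal_ofReal hc0, mul_comm] at h2

theorem IsMarkovChain.real_shift_preimage (hP : IsMarkovChain q P) (x : V) (t : ℝ≥0)
    {S : Set (Path V)} (hS : MeasurableSet S) :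
    (P x).real (shift t ⁻¹' S) = ∑ y, (P x).real {ω | X t ω = y} * (P y).real S := by
  classical
  have := hP.isProb
  have hm : ∀ y, MeasurableSet {ω : Path V | X t ω = y} := fun y => measurableSet_X t {y}
  have h := hP.markov x t Set.univ S MeasurableSet.univ hS
  rw [Set.univ_inter, Measure.restrict_univ] at h
  have h2 : ∫⁻ ω, P (X t ω) S ∂(P x) = ∑ y, P y S * P x {ω | X t ω = y} := by
    rw [← Finset.sum_congr rfl fun y _ => lintegral_indicator_const (μ := P x) (hm y) (P y S),
      ← lintegral_finsetSum _ fun y _ => measurable_const.indicator (hm y)]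
    refine lintegral_congr fun ω => ?_
    rw [Finset.sum_eq_single (X t ω)]
    · rw [Set.indicator_of_mem]; rfl
    · intro y _ hy
      have hn : ω ∉ {ω : Path V | X t ω = y} := fun h' => hy (Eq.symm h')
      exact Set.indicator_of_notMem hn _
    · simp
  rw [measureReal_def, h, h2, ENNReal.toReal_sum fun y _ => by finiteness]
  exact Finset.sum_congr rfl fun y _ => by rw [ENNReal.toReal_mul, mul_comm]; rfl

/-- Sums of a `[0, 1]`-valued function against two mass functions differ by at most their total
variation distance. -/
theorem sum_mul_le_add_tvDist {p p' f : V → ℝ} (hp : ∑ x, p x = ∑ x, p' x)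
    (hf : ∀ x, f x ∈ Set.Icc (0 : ℝ) 1) :
    ∑ x, p x * f x ≤ ∑ x, p' x * f x + tvDist p p' := by
  -- The masses agree, so `f` may be centred at `1 / 2`; then `|f - 1 / 2| ≤ 1 / 2` supplies the
  -- factor in `tvDist`.
  have h1 : ∑ x, (p x - p' x) * (f x - 1 / 2) ≤ tvDist p p' := by
    rw [tvDist, Finset.mul_sum]
    refine Finset.sum_le_sum fun x _ => ?_
    refine (le_abs_self _).trans ?_
    rw [abs_mul, mul_comm]
    refine mul_le_mul_of_nonneg_right ?_ (abs_nonneg _)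
    rw [abs_le]
    constructor <;> linarith [(hf x).1, (hf x).2]
  have h2 : ∑ x, (p x - p' x) * (f x - 1 / 2)
      = ∑ x, p x * f x - ∑ x, p' x * f x - (1 / 2) * (∑ x, p x - ∑ x, p' x) := by
    rw [mul_sub, Finset.mul_sum, Finset.mul_sum, ← Finset.sum_sub_distrib,
      ← Finset.sum_sub_distrib, ← Finset.sum_sub_distrib]
    exact Finset.sum_congr rfl fun x _ => by ring
  rw [hp, sub_self, mul_zero, sub_zero] at h2
  linarith

theorem IsMarkovChain.sum_real_X (hP : IsMarkovChain q P) (x : V) (t : ℝ≥0) :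
    ∑ y, (P x).real {ω | X t ω = y} = 1 := by
  have := hP.isProb
  have h := hP.real_shift_preimage x t (S := Set.univ) MeasurableSet.univ
  simpa using h.symm

/-- Once the chain is `κ`-mixed, shifted events have up to `κ` their stationary probability. -/
theorem IsMarkovChain.real_shift_preimage_le (hP : IsMarkovChain q P) {κ : ℝ} {T : ℝ≥0}
    (hT : MixedAt P π κ T) (x : V) {S : Set (Path V)} (hS : MeasurableSet S) :
    (P x).real (shift T ⁻¹' S) ≤ (startedFrom P π).real S + κ := by
  have := hP.isProb
  rw [hP.real_shift_preimage x T hS, hP.startedFrom_real]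
  refine (sum_mul_le_add_tvDist (p' := fun y => (π y).toReal) ?_ fun y => ?_).trans
    (by gcongr; exact hT x)
  · rw [hP.sum_real_X, sum_toReal_pmf]
  · exact ⟨measureReal_nonneg, measureReal_le_one⟩

/-- The infimum is attained because the one-time marginals are right-continuous in time. -/
theorem IsMixing.mixedAt_mixingTime (hP : IsMarkovChain q P) (hπ : IsMixing P π) {α : ℝ}
    (h0 : 0 < α) (h1 : α < 1) : MixedAt P π α (mixingTime P π α) := by
  have hne : {T | MixedAt P π α T}.Nonempty := hπ.mixed α h0 h1
  obtain ⟨u, -, hu, hmem⟩ := exists_seq_tendsto_sInf hne (OrderBot.bddBelow _)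
  have hu' : Tendsto u atTop (𝓝[≥] (mixingTime P π α)) :=
    tendsto_nhdsWithin_iff.2 ⟨hu, Eventually.of_forall fun n =>
      csInf_le (OrderBot.bddBelow _) (hmem n)⟩
  intro x
  refine le_of_tendsto (f := fun n => tvDist (fun s => (P x).real {ω | X (u n) ω = s})
    (fun s => (π s).toReal)) (x := atTop) ?_ (Eventually.of_forall fun n => hmem n x)
  exact (tendsto_finsetSum _ fun y _ =>
    (((hP.tendsto_real_X x y _).comp hu').sub tendsto_const_nhds).abs).const_mul _

theorem IsMixing.mixingTime_anti (hπ : IsMixing P π) {α α' : ℝ} (h0 : 0 < α)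
    (h : α ≤ α') (h1 : α' < 1) : mixingTime P π α' ≤ mixingTime P π α :=
  csInf_le_csInf (OrderBot.bddBelow _) (hπ.mixed α h0 (h.trans_lt h1))
    fun _ hT x => (hT x).trans h

theorem IsMarkovChain.real_compl_hitBy (hP : IsMarkovChain q P) (μ : PMF V) (B : Set V)
    (t : ℝ≥0) : (startedFrom P μ).real (hitBy B t)ᶜ = 1 - (startedFrom P μ).real (hitBy B t) := by
  have := hP.isProbabilityMeasure_startedFrom μ
  exact probReal_compl_eq_one_sub (measurableSet_hitBy B t)

theorem IsMarkovChain.real_hitBy_mono (hP : IsMarkovChain q P) (μ : PMF V) (B : Set V)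
    {t u : ℝ≥0} (h : t ≤ u) :
    (startedFrom P μ).real (hitBy B t) ≤ (startedFrom P μ).real (hitBy B u) := by
  have := hP.isProbabilityMeasure_startedFrom μ
  exact measureReal_mono (hitBy_mono B h)

theorem IsStationary.real_hitBy_add_le (hπ : IsStationary P π)
    (B : Set V) (t s : ℝ≥0) :
    (startedFrom P π).real (hitBy B (t + s)) ≤
      (startedFrom P π).real (hitBy B t) + (startedFrom P π).real (hitBy B s) := by
  rw [hitBy_add]
  refine (measureReal_union_le _ _).trans (le_of_eq ?_)
  rw [measureReal_def (s := shift t ⁻¹' _), hπ t _ (measurableSet_hitBy B s)]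
  rfl

theorem IsStationary.real_hitBy_nsmul_le (hπ : IsStationary P π)
    (B : Set V) (t : ℝ≥0) (n : ℕ) :
    (startedFrom P π).real (hitBy B ((n + 1 : ℕ) * t)) ≤
      (n + 1 : ℕ) * (startedFrom P π).real (hitBy B t) := by
  induction n with
  | zero => simp
  | succ n ih =>
    have h := hπ.real_hitBy_add_le B ((n + 1 : ℕ) * t) t
    rw [show ((n + 1 : ℕ) : ℝ≥0) * t + t = ((n + 1 + 1 : ℕ) : ℝ≥0) * t by push_cast; ring] at h
    rw [show ((n + 1 + 1 : ℕ) : ℝ) = ((n + 1 : ℕ) : ℝ) + 1 by push_cast; ring]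
    linarith

/-- Geometric decay of survival probabilities from a uniform one-step bound. -/
theorem IsMarkovChain.real_compl_hitBy_le_pow (hP : IsMarkovChain q P) (μ : PMF V) (B : Set V)
    {s : ℝ≥0} {θ : ℝ} (hθ : ∀ x, (P x).real (hitBy B s)ᶜ ≤ θ) (k : ℕ) :
    (startedFrom P μ).real (hitBy B (k * s))ᶜ ≤ θ ^ k := by
  have hp := hP.isProbabilityMeasure_startedFrom μ
  have hθ0 : 0 ≤ θ := by
    obtain ⟨x, -⟩ := μ.support_nonempty
    exact measureReal_nonneg.trans (hθ x)
  induction k with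
  | zero => simp
  | succ k ih =>
    have h := hP.real_inter_shift_le μ (t := k * s)
      (@MeasurableSet.compl _ _ (pastSigma V (k * s)) (measurableSet_past_hitBy B (k * s)))
      (measurableSet_hitBy B s).compl hθ
    rw [Set.preimage_compl, ← Set.compl_union, ← hitBy_add,
      show (k : ℝ≥0) * s + s = ((k + 1 : ℕ) : ℝ≥0) * s by push_cast; ring] at h
    rw [pow_succ]
    exact h.trans (mul_le_mul_of_nonneg_right ih hθ0)

/-- From any state, the probability of avoiding `B` during a period longer than the mixing time
is nearly at most the stationary one. -/
theorem IsMarkovChain.real_compl_hitBy_le (hP : IsMarkovChain q P) (hπ : IsStationary P π)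
    (B : Set V) {κ : ℝ} {T s : ℝ≥0} (hT : MixedAt P π κ T) (hTs : T ≤ s) (x : V) :
    (P x).real (hitBy B s)ᶜ ≤ 1 - ((startedFrom P π).real (hitBy B s)
      - (startedFrom P π).real (hitBy B T) - κ) := by
  have := hP.isProb
  obtain ⟨u, rfl⟩ := exists_add_of_le hTs
  have h1 := hP.real_shift_preimage_le hT x (measurableSet_hitBy B u).compl
  rw [hP.real_compl_hitBy] at h1
  have h2 : (P x).real (hitBy B (T + u))ᶜ ≤ (P x).real (shift T ⁻¹' (hitBy B u)ᶜ) := by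
    refine measureReal_mono ?_
    rw [hitBy_add, Set.compl_union, Set.preimage_compl]
    exact Set.inter_subset_right
  have h3 := hπ.real_hitBy_add_le B T u
  linarith

/-- The Markov property is applied a time `T` before each window where a hit must be excluded, so
that the chain has mixed. Conditioning on survival to `u + T` controls hits after `u + 2T`. Hits
between `u + T` and `u + 2T` require going back to `u`, whence the error term carries survival to
`u` instead. -/
theorem IsMarkovChain.real_compl_hitBy_add_ge (hP : IsMarkovChain q P)
    (μ : PMF V) (B : Set V) {κ : ℝ} {T : ℝ≥0} (hT : MixedAt P π κ T) (u s : ℝ≥0) :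
    (startedFrom P μ).real (hitBy B (u + T))ᶜ * (1 - (startedFrom P π).real (hitBy B s) - κ)
      - (startedFrom P μ).real (hitBy B u)ᶜ * ((startedFrom P π).real (hitBy B T) + κ)
      ≤ (startedFrom P μ).real (hitBy B (u + T + s))ᶜ := by
  have hp := hP.isProbabilityMeasure_startedFrom μ
  have hm := @measurableSet_hitBy V B
  have e1 := hP.real_inter_shift_le μ (t := u + T)
      (@MeasurableSet.compl _ _ (pastSigma V (u + T)) (measurableSet_past_hitBy B (u + T)))
      (measurable_shift T (hm s)) fun x => hP.real_shift_preimage_le hT x (hm s)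
  have e2 := hP.real_inter_shift_le μ (t := u)
      (@MeasurableSet.compl _ _ (pastSigma V u) (measurableSet_past_hitBy B u))
      (measurable_shift T (hm T)) fun x => hP.real_shift_preimage_le hT x (hm T)
  have hsub : (hitBy B (u + T))ᶜ ⊆ (hitBy B (u + T + s))ᶜ ∪
      (((hitBy B (u + T))ᶜ ∩ shift (u + T) ⁻¹' (shift T ⁻¹' hitBy B s)) ∪
      ((hitBy B u)ᶜ ∩ shift u ⁻¹' (shift T ⁻¹' hitBy B T))) := by
    intro ω hω
    by_cases h : ω ∈ hitBy B (u + T + s)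
    · refine Or.inr ?_
      have hu : ω ∉ hitBy B u := fun h' => hω (hitBy_mono B le_self_add h')
      obtain ⟨v, hv, hB⟩ := h
      have hv1 : u + T ≤ v := (not_le.1 fun h' => hω ⟨v, h', hB⟩).le
      rcases le_total v (u + T + T) with h2 | h2
      · refine Or.inr ⟨hu, v - (u + T), tsub_le_iff_left.2 h2, ?_⟩
        change ω.1 (v - (u + T) + T + u) ∈ B
        rwa [add_assoc, add_comm T u, tsub_add_cancel_of_le hv1]
      · refine Or.inl ⟨hω, v - (u + T + T), tsub_le_iff_left.2 ?_, ?_⟩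
        · exact hv.trans (by gcongr; exact le_self_add)
        · change ω.1 (v - (u + T + T) + T + (u + T)) ∈ B
          rwa [add_assoc, add_comm T, tsub_add_cancel_of_le h2]
    · exact Or.inl h
  have h1 := (measureReal_mono (μ := startedFrom P μ) hsub).trans (measureReal_union_le _ _)
  have h2 := h1.trans (add_le_add_right (measureReal_union_le _ _) _)
  linarith

/-- Geometric lower bound on survival probabilities. -/
theorem IsMarkovChain.pow_le_real_compl_hitBy (hP : IsMarkovChain q P)
    (μ : PMF V) (B : Set V) {κ p : ℝ} {T s : ℝ≥0} (hκ : 0 ≤ κ) (hT : MixedAt P π κ T)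
    (hTs : T ≤ s)
    (hp : (startedFrom P π).real (hitBy B s) + κ + 2 * ((startedFrom P π).real (hitBy B T) + κ) ≤ p)
    (hp1 : p ≤ 1 / 2) (hr : (startedFrom P μ).real (hitBy B T) ≤ 1 / 2) (k : ℕ) :
    (1 - (startedFrom P μ).real (hitBy B T)) * (1 - p) ^ k ≤
      (startedFrom P μ).real (hitBy B (T + k * s))ᶜ := by
  have hprob := hP.isProbabilityMeasure_startedFrom μ
  have hη : 0 ≤ (startedFrom P π).real (hitBy B T) + κ := add_nonneg measureReal_nonneg hκ
  have step : ∀ k : ℕ, (startedFrom P μ).real (hitBy B (k * s))ᶜ ≤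
        2 * (startedFrom P μ).real (hitBy B (T + k * s))ᶜ →
      (1 - p) * (startedFrom P μ).real (hitBy B (T + k * s))ᶜ ≤
        (startedFrom P μ).real (hitBy B (T + (k + 1 : ℕ) * s))ᶜ := by
    intro k hk
    have h := hP.real_compl_hitBy_add_ge μ B hT (k * s) s
    rw [show (k : ℝ≥0) * s + T + s = T + ((k + 1 : ℕ) : ℝ≥0) * s by push_cast; ring,
      add_comm ((k : ℝ≥0) * s) T] at h
    have hg : 0 ≤ (startedFrom P μ).real (hitBy B (T + k * s))ᶜ := measureReal_nonneg
    have h2 := mul_le_mul_of_nonneg_right hk hη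
    have h3 := mul_le_mul_of_nonneg_left hp hg
    nlinarith
  -- The halving hypothesis propagates: `T ≤ s` gives `g ((k + 1) s) ≤ g (T + k s)`, and the
  -- previous step loses at most a factor `1 - p ≥ 1 / 2`. The base case is `hr`.
  have ratio : ∀ k : ℕ, (startedFrom P μ).real (hitBy B (k * s))ᶜ ≤
        2 * (startedFrom P μ).real (hitBy B (T + k * s))ᶜ := by
    intro k
    induction k with
    | zero =>
      rw [hP.real_compl_hitBy μ B (T + _)]
      simp only [Nat.cast_zero, zero_mul, add_zero]
      have : (startedFrom P μ).real (hitBy B 0)ᶜ ≤ 1 := measureReal_le_one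
      linarith
    | succ k ih =>
      have h1 : (startedFrom P μ).real (hitBy B ((k + 1 : ℕ) * s))ᶜ ≤
          (startedFrom P μ).real (hitBy B (T + k * s))ᶜ := by
        refine measureReal_mono (Set.compl_subset_compl.2 (hitBy_mono B ?_))
        rw [show ((k + 1 : ℕ) : ℝ≥0) * s = s + k * s by push_cast; ring]
        gcongr
      have hg : 0 ≤ (startedFrom P μ).real (hitBy B (T + k * s))ᶜ := measureReal_nonneg
      nlinarith [step k ih]
  induction k with
  | zero => simp [hP.real_compl_hitBy]
  | succ k ih =>
    rw [pow_succ, ← mul_assoc, mul_comm]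
    exact (mul_le_mul_of_nonneg_left ih (by linarith)).trans (step k (ratio k))

end Chain

/-! ### Mean hitting times as geometric sums, and inclusion–exclusion. -/

section HittingTime

variable {V : Type*}

theorem lintegral_ite_lt_hittingTime (Q : Measure (Path V)) [IsProbabilityMeasure Q] (B : Set V)
    (t s : ℝ≥0) :
    ∫⁻ ω, (if (t : ℝ≥0∞) < hittingTime B ω then (s : ℝ≥0∞) else 0) ∂Q =
      ENNReal.ofReal (s * Q.real (hitBy B t)ᶜ) := by
  rw [ENNReal.ofReal_mul s.coe_nonneg, ofReal_measureReal, ENNReal.ofReal_coe_nnreal,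
    ← lintegral_indicator_const (measurableSet_hitBy B t).compl]
  refine lintegral_congr fun ω => ?_
  rw [← setOf_lt_hittingTime, Set.indicator_apply]
  rfl

theorem measurable_ite_lt_hittingTime (B : Set V) (t s : ℝ≥0) :
    Measurable fun ω : Path V => if (t : ℝ≥0∞) < hittingTime B ω then (s : ℝ≥0∞) else 0 :=
  Measurable.ite (measurableSet_lt measurable_const (measurable_hittingTime B))
    measurable_const measurable_const

theorem lintegral_hittingTime_le (Q : Measure (Path V)) [IsProbabilityMeasure Q] (B : Set V)
    {s : ℝ≥0} (hs : 0 < s) {θ : ℝ} (h0 : 0 ≤ θ) (h1 : θ < 1)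
    (h : ∀ k : ℕ, Q.real (hitBy B (k * s))ᶜ ≤ θ ^ k) :
    ∫⁻ ω, hittingTime B ω ∂Q ≤ ENNReal.ofReal (s / (1 - θ)) := by
  refine (lintegral_mono fun ω => le_tsum_indicator_multiples hs (hittingTime B ω)).trans ?_
  rw [lintegral_tsum fun k => (measurable_ite_lt_hittingTime B _ s).aemeasurable]
  simp_rw [lintegral_ite_lt_hittingTime]
  have hsum : Summable fun k : ℕ => (s : ℝ) * θ ^ k :=
    (summable_geometric_of_lt_one h0 h1).mul_left _
  rw [div_eq_mul_inv, ← tsum_geometric_of_lt_one h0 h1, ← tsum_mul_left,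
    ENNReal.ofReal_tsum_of_nonneg (fun k => by positivity) hsum]
  exact ENNReal.tsum_le_tsum fun k =>
    ENNReal.ofReal_le_ofReal (mul_le_mul_of_nonneg_left (h k) s.coe_nonneg)

theorem le_lintegral_hittingTime (Q : Measure (Path V)) [IsProbabilityMeasure Q] (B : Set V)
    (s : ℝ≥0) {θ c : ℝ} (hc : 0 ≤ c) (h0 : 0 ≤ θ) (h1 : θ < 1)
    (h : ∀ k : ℕ, c * θ ^ k ≤ Q.real (hitBy B ((k + 1 : ℕ) * s))ᶜ) :
    ENNReal.ofReal (s * c / (1 - θ)) ≤ ∫⁻ ω, hittingTime B ω ∂Q := by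
  refine le_trans ?_ (lintegral_mono fun ω => tsum_indicator_multiples_le s (hittingTime B ω))
  rw [lintegral_tsum fun k => (measurable_ite_lt_hittingTime B _ s).aemeasurable]
  simp_rw [lintegral_ite_lt_hittingTime]
  have hsum : Summable fun k : ℕ => (s * c : ℝ) * θ ^ k :=
    (summable_geometric_of_lt_one h0 h1).mul_left _
  rw [div_eq_mul_inv, ← tsum_geometric_of_lt_one h0 h1, ← tsum_mul_left,
    ENNReal.ofReal_tsum_of_nonneg (fun k => by positivity) hsum]
  refine ENNReal.tsum_le_tsum fun k => ENNReal.ofReal_le_ofReal ?_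
  rw [mul_assoc]
  exact mul_le_mul_of_nonneg_left (h k) s.coe_nonneg

theorem mul_real_compl_hitBy_le_lintegral (Q : Measure (Path V)) [IsProbabilityMeasure Q]
    (B : Set V) (t : ℝ≥0) :
    ENNReal.ofReal (t * Q.real (hitBy B t)ᶜ) ≤ ∫⁻ ω, hittingTime B ω ∂Q := by
  rw [← lintegral_ite_lt_hittingTime]
  refine lintegral_mono fun ω => ?_
  dsimp only
  split_ifs with h
  exacts [h.le, zero_le]

/-- Excludes `m = 0` in the theorem: an immediate hit contradicts the rarity of hits before the
mixing time. -/
theorem real_hitBy_zero_of_lintegral_eq_zero {Q : Measure (Path V)} [IsProbabilityMeasure Q]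
    {B : Set V} (h : ∫⁻ ω, hittingTime B ω ∂Q = 0) : Q.real (hitBy B 0) = 1 := by
  have h1 := (lintegral_eq_zero_iff (measurable_hittingTime B)).1 h
  have h2 : ∀ᵐ ω ∂Q, ω ∈ hitBy B 0 := by
    filter_upwards [h1] with ω hω
    rw [← hittingTime_le_iff, hω]
    simp
  have h3 : hitBy B 0 =ᵐ[Q] Set.univ := eventuallyEq_univ.2 h2
  rw [measureReal_def, measure_congr h3, measure_univ, ENNReal.toReal_one]

/-- The second Bonferroni inequality. -/
theorem sum_real_sub_sum_real_inter_le {Ω : Type*} [MeasurableSpace Ω] (Q : Measure Ω)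
    [IsProbabilityMeasure Q] {l : ℕ} {E : Fin l → Set Ω} (hE : ∀ i, MeasurableSet (E i)) :
    ∑ i, Q.real (E i) - ∑ p : Fin l × Fin l with p.1 < p.2, Q.real (E p.1 ∩ E p.2)
      ≤ Q.real (⋃ i, E i) := by
  classical
  -- `F i` collects the points whose first index is `i`. These sets are disjoint, and what `E i`
  -- loses lies in its intersections with earlier `E j`.
  let F : Fin l → Set Ω := fun i => E i \ ⋃ j ∈ Finset.univ.filter (· < i), E j
  have hF : ∀ i, MeasurableSet (F i) := fun i =>
    (hE i).diff (Finset.measurableSet_biUnion _ fun j _ => hE j)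
  have hlt : ∀ i j, i < j → Disjoint (F i) (F j) := by
    intro i j hij
    refine Set.disjoint_left.2 fun ω hi hj => hj.2 ?_
    exact Set.mem_biUnion (by simpa using hij) hi.1
  have hd : ((Finset.univ : Finset (Fin l)) : Set (Fin l)).PairwiseDisjoint F := by
    intro i _ j _ hij
    rcases lt_or_gt_of_ne hij with h | h
    exacts [hlt i j h, (hlt j i h).symm]
  have h1 : ∑ i, Q.real (F i) ≤ Q.real (⋃ i, E i) := by
    rw [← measureReal_biUnion_finset hd fun i _ => hF i]
    refine measureReal_mono ?_
    simp only [Finset.mem_univ, Set.iUnion_true]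
    exact Set.iUnion_mono fun i => Set.sdiff_subset
  have h2 : ∀ i, Q.real (E i) - ∑ j, (if j < i then Q.real (E j ∩ E i) else 0) ≤ Q.real (F i) := by
    intro i
    have hsub : E i ⊆ F i ∪ ⋃ j ∈ Finset.univ.filter (· < i), E j ∩ E i := by
      intro ω hω
      by_cases h : ω ∈ ⋃ j ∈ Finset.univ.filter (· < i), E j
      · right
        simp only [Set.mem_iUnion] at h ⊢
        obtain ⟨j, hj, hjω⟩ := h
        exact ⟨j, hj, hjω, hω⟩
      · exact Or.inl ⟨hω, h⟩
    have h3 := (measureReal_mono (μ := Q) hsub).trans (measureReal_union_le _ _)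
    have h4 := h3.trans (add_le_add_right (measureReal_biUnion_finset_le _ _) _)
    rw [Finset.sum_filter] at h4
    linarith
  have h5 := Finset.sum_le_sum fun i (_ : i ∈ Finset.univ) => h2 i
  rw [Finset.sum_sub_distrib, Finset.sum_comm] at h5
  rw [Finset.sum_filter, Fintype.sum_prod_type]
  exact h5.trans h1

end HittingTime

/-! ### From mean hitting times to one-period probabilities to exponential laws. -/

section NearExponential

variable {V : Type*} [Fintype V] {q : V → V → ℝ} {P : V → Measure (Path V)} {π : PMF V}

/-- Sets charged by the stationary distribution have finite mean hitting times. -/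
theorem IsMixing.lintegral_hittingTime_ne_top (hP : IsMarkovChain q P) (hπ : IsMixing P π)
    (μ : PMF V) {B : Set V} {x : V} (hx : x ∈ B) (hπx : π x ≠ 0) :
    ∫⁻ ω, hittingTime B ω ∂(startedFrom P μ) ≠ ∞ := by
  have hp := hP.isProb
  have hp' := hP.isProbabilityMeasure_startedFrom μ
  have h0 : 0 < (π x).toReal := ENNReal.toReal_pos hπx (π.apply_ne_top x)
  have h1 : (π x).toReal ≤ 1 := 
    ENNReal.toReal_le_of_le_ofReal zero_le_one (by simpa using π.coe_le_one x)
  -- Total variation is half the sum, so error `π x / 4` forces every state to be at `x` at time `T`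
  -- with probability at least `π x / 2`. The period `T + 1` is used below because it must be
  -- positive.
  obtain ⟨T, hT⟩ := hπ.mixed ((π x).toReal / 4) (by linarith) (by linarith)
  have hθ : ∀ y, (P y).real (hitBy B (T + 1))ᶜ ≤ 1 - (π x).toReal / 2 := by
    intro y
    have h2 : |(P y).real {ω | X T ω = x} - (π x).toReal| ≤ (π x).toReal / 2 := by
      have h3 := hT y
      rw [tvDist] at h3
      have h4 := Finset.single_le_sum
        (f := fun s => |(P y).real {ω | X T ω = s} - (π s).toReal|)
        (fun s _ => abs_nonneg _) (Finset.mem_univ x)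
      linarith
    have h5 : (P y).real {ω | X T ω = x} ≤ (P y).real (hitBy B (T + 1)) :=
      measureReal_mono fun ω (hω : X T ω = x) => ⟨T, le_self_add, hω ▸ hx⟩
    rw [probReal_compl_eq_one_sub (measurableSet_hitBy _ _)]
    linarith [(abs_le.1 h2).1]
  have h6 := lintegral_hittingTime_le (startedFrom P μ) B (s := T + 1) (by positivity)
    (by linarith) (by linarith) (hP.real_compl_hitBy_le_pow μ B hθ)
  exact ne_top_of_le_ne_top ENNReal.ofReal_ne_top h6

/-- If hitting `B` before the mixing time `T` is unlikely, then `T` is short compared with the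
mean hitting time `m`. -/
theorem IsMarkovChain.le_mul_mean_hittingTime (hP : IsMarkovChain q P) (hπ : IsStationary P π)
    {B : Set V} {T m : ℝ≥0} {δ ε : ℝ} (hδ0 : 0 < δ) (hδ : δ < 1 / 5) (hε0 : 0 < ε) (hε : ε ≤ 1)
    (hm : ∫⁻ ω, hittingTime B ω ∂(startedFrom P π) = m)
    (hB : (startedFrom P π).real (hitBy B T) ≤ δ * ε / 2) : (T : ℝ) ≤ ε * m := by
  have hp' := hP.isProbabilityMeasure_startedFrom π
  -- By subadditivity, about `2 / ε` periods of length `T` still carry hitting probability at most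
  -- `1 / 2`; Markov's inequality then gives `m ≥ (n + 1) T / 2 ≥ T / ε`.
  obtain ⟨n, hn⟩ : ∃ n, ⌈2 / ε⌉₊ = n + 1 :=
    Nat.exists_eq_succ_of_ne_zero (Nat.ceil_pos.2 (by positivity)).ne'
  have h1 : 2 ≤ ((n + 1 : ℕ) : ℝ) * ε := by
    rw [← div_le_iff₀ hε0, ← hn]; exact Nat.le_ceil _
  have h2 : ((n + 1 : ℕ) : ℝ) * ε ≤ 3 := by
    have h3 : ((n + 1 : ℕ) : ℝ) < 2 / ε + 1 := by
      rw [← hn]; exact Nat.ceil_lt_add_one (by positivity)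
    have h4 := mul_le_mul_of_nonneg_right h3.le hε0.le
    rw [add_mul, div_mul_cancel₀ _ hε0.ne'] at h4
    linarith
  have h5 := hπ.real_hitBy_nsmul_le B T n
  have h6 := mul_real_compl_hitBy_le_lintegral (startedFrom P π) B ((n + 1 : ℕ) * T)
  rw [hm, hP.real_compl_hitBy, ← ENNReal.ofReal_coe_nnreal, ENNReal.ofReal_le_ofReal_iff m.coe_nonneg] at h6
  push_cast at h1 h2 h5 h6
  have h7 : (startedFrom P π).real (hitBy B ((n + 1) * T)) ≤ 1 / 2 := by
    have h8 := mul_le_mul_of_nonneg_left hB (by positivity : (0 : ℝ) ≤ n + 1)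
    nlinarith
  have hT : (0 : ℝ) ≤ T := T.coe_nonneg
  have h9 : ((n : ℝ) + 1) * T * (1 / 2) ≤ m := by
    refine le_trans (mul_le_mul_of_nonneg_left ?_ (by positivity)) h6
    linarith
  nlinarith [mul_le_mul_of_nonneg_left h9 hε0.le, mul_le_mul_of_nonneg_right h1 hT]

/-- The stationary probability of hitting `B` before a small multiple `ε m` of its mean hitting
time is close to `ε`. -/
theorem IsMarkovChain.real_hitBy_mul_mean_mem_Icc (hP : IsMarkovChain q P)
    (hπ : IsStationary P π) {B : Set V} {T m s : ℝ≥0} {δ ε : ℝ} (hδ0 : 0 < δ) (hδ : δ ≤ 1 / 100)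
    (hε0 : 0 < ε) (hε : ε ≤ δ / 2) (hm0 : 0 < m)
    (hm : ∫⁻ ω, hittingTime B ω ∂(startedFrom P π) = m)
    (hT : MixedAt P π (δ * ε / 2) T) (hTs : T ≤ s) (hs : (s : ℝ) = ε * m)
    (hB : (startedFrom P π).real (hitBy B T) ≤ δ * ε / 2) :
    (startedFrom P π).real (hitBy B s) ∈ Set.Icc (ε * (1 - 5 * δ)) (ε * (1 + δ)) := by
  have hp' := hP.isProbabilityMeasure_startedFrom π
  have hmr : (0 : ℝ) < m := by exact_mod_cast hm0
  have hs0 : 0 < s := by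
    have : (0 : ℝ) < s := by rw [hs]; positivity
    exact_mod_cast this
  have hδε : 0 < δ * ε := mul_pos hδ0 hε0
  have hp1 : (startedFrom P π).real (hitBy B s) ≤ 1 := measureReal_le_one
  have hp0 : 0 ≤ (startedFrom P π).real (hitBy B s) := measureReal_nonneg
  have hup : (startedFrom P π).real (hitBy B s) ≤ ε * (1 + δ) := by
    -- Only above `δ ε` is the geometric ratio below 1; then `m ≤ ε m / (p - δ ε)`.
    rcases le_or_gt ((startedFrom P π).real (hitBy B s)) (δ * ε) with h | h
    · nlinarith
    · have hθ : ∀ x, (P x).real (hitBy B s)ᶜ ≤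
          1 - ((startedFrom P π).real (hitBy B s) - δ * ε) := fun x =>
        (hP.real_compl_hitBy_le hπ B hT hTs x).trans (by linarith)
      have h1 := lintegral_hittingTime_le (startedFrom P π) B hs0 (by linarith) (by linarith)
        (hP.real_compl_hitBy_le_pow π B hθ)
      rw [hm, ← ENNReal.ofReal_coe_nnreal, sub_sub_cancel, ENNReal.ofReal_le_ofReal_iff
        (div_nonneg s.coe_nonneg (by linarith)), le_div_iff₀ (by linarith), hs, mul_comm ε] at h1
      have h2 := le_of_mul_le_mul_left h1 hmr
      linarith
  refine ⟨?_, hup⟩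
  -- The surplus `5/2 δ ε` is `κ + 2 (δ ε / 2 + κ)` with `κ = δ ε / 2`.
  obtain ⟨p', hp'e⟩ : ∃ p', p' = (startedFrom P π).real (hitBy B s) + 5 / 2 * (δ * ε) := ⟨_, rfl⟩
  have hδε2 : δ * ε ≤ ε / 100 := by nlinarith
  have hple : p' ≤ δ := by nlinarith
  have hp'0 : 0 < p' := by linarith
  have hr : (startedFrom P π).real (hitBy B T) ≤ 1 / 2 := by linarith
  have hlow := hP.pow_le_real_compl_hitBy π B (κ := δ * ε / 2) (p := p') (by linarith) hT hTs
    (by linarith) (by linarith) hr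
  have hc : 0 ≤ (1 - (startedFrom P π).real (hitBy B T)) * (1 - p') :=
    mul_nonneg (by linarith) (by linarith)
  -- The lower Riemann sum samples at `(k + 1) s`, so one factor `1 - p'` moves into the constant.
  have h1 := le_lintegral_hittingTime (startedFrom P π) B s hc (θ := 1 - p') (by linarith)
    (by linarith) fun k => by
      rw [mul_assoc, ← pow_succ']
      exact (hlow (k + 1)).trans (measureReal_mono (Set.compl_subset_compl.2
        (hitBy_mono B le_add_self)))
  rw [hm, ← ENNReal.ofReal_coe_nnreal, sub_sub_cancel, ENNReal.ofReal_le_ofReal_iff m.coe_nonneg,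
    div_le_iff₀ hp'0, hs, mul_comm ε, mul_assoc] at h1
  have h2 := le_of_mul_le_mul_left h1 hmr
  have h3 : (1 - δ) * (1 - δ) ≤ (1 - (startedFrom P π).real (hitBy B T)) * (1 - p') :=
    mul_le_mul (by linarith) (by linarith) (by linarith) (by linarith)
  have h4 := mul_le_mul_of_nonneg_left h3 hε0.le
  nlinarith [mul_nonneg hε0.le (sq_nonneg δ)]

/-- From `1 / (1 - p) = 1 + p / (1 - p) ≤ exp (p / (1 - p))`; rounding up costs the prefactor `1 -
p`. -/
theorem exp_mul_le_one_sub_pow {p u : ℝ} (hp0 : 0 ≤ p) (hp1 : p < 1) (hu : 0 < u) :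
    (1 - p) * Real.exp (-(p / (1 - p)) * u) ≤ (1 - p) ^ ⌈u⌉₊ := by
  obtain ⟨j, hj⟩ := Nat.exists_eq_succ_of_ne_zero (Nat.ceil_pos.2 hu).ne'
  have hju : (j : ℝ) ≤ u := by
    have := Nat.ceil_lt_add_one hu.le
    rw [hj] at this
    push_cast at this
    linarith
  have hq : 0 < 1 - p := by linarith
  have h1 : Real.exp (-(p / (1 - p))) ≤ 1 - p := by
    rw [Real.exp_neg, inv_le_comm₀ (Real.exp_pos _) hq]
    refine le_trans (le_of_eq ?_) (Real.add_one_le_exp _)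
    field_simp
    ring
  rw [hj, Nat.succ_eq_add_one, pow_succ']
  refine mul_le_mul_of_nonneg_left ?_ hq.le
  refine le_trans ?_ (pow_le_pow_left₀ (Real.exp_pos _).le h1 j)
  rw [← Real.exp_nat_mul, Real.exp_le_exp]
  have : 0 ≤ p / (1 - p) := div_nonneg hp0 hq.le
  nlinarith

/-- From `1 - p ≤ exp (-p)`; the exponent may fall short of `u` by one, which costs `exp p ≤ 1 + 2
p`. -/
theorem one_sub_pow_le_exp_mul {p u : ℝ} (hp0 : 0 ≤ p) (hp1 : p ≤ 1 / 2) {k : ℕ}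
    (hk : u ≤ k + 1) : (1 - p) ^ k ≤ (1 + 2 * p) * Real.exp (-p * u) := by
  have h1 : Real.exp p ≤ 1 + 2 * p := by
    refine (Real.exp_bound_div_one_sub_of_interval hp0 (by linarith)).trans ?_
    rw [div_le_iff₀ (by linarith)]
    nlinarith
  calc (1 - p) ^ k ≤ Real.exp (-p) ^ k :=
        pow_le_pow_left₀ (by linarith) (by linarith [Real.add_one_le_exp (-p)]) k
    _ = Real.exp (k * -p) := (Real.exp_nat_mul _ _).symm
    _ ≤ Real.exp (p + -p * u) := Real.exp_le_exp.2 (by nlinarith)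
    _ = Real.exp p * Real.exp (-p * u) := Real.exp_add _ _
    _ ≤ _ := mul_le_mul_of_nonneg_right h1 (Real.exp_pos _).le

/-- If `B` is hit from stationarity with probability about `L` during a period `s = L M`, and
hardly before the mixing time, then its hitting time is nearly exponential with mean `M`. -/
theorem IsMarkovChain.isNearExp_hittingTime (hP : IsMarkovChain q P) (hπ : IsStationary P π)
    {B : Set V} {T s : ℝ≥0} {κ L M D : ℝ} (hκ : 0 ≤ κ) (hT : MixedAt P π κ T) (hTs : T ≤ s)
    (hL0 : 0 < L) (hL : L ≤ D) (hD : D ≤ 1 / 100) (hM : 0 < M) (hs : (s : ℝ) = L * M)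
    (hlow : L * (1 - 7 * D) ≤ (startedFrom P π).real (hitBy B s)
      - (startedFrom P π).real (hitBy B T) - κ)
    (hup : (startedFrom P π).real (hitBy B s) + κ
      + 2 * ((startedFrom P π).real (hitBy B T) + κ) ≤ L * (1 + 5 * D)) (μ : PMF V) :
    IsNearExp (startedFrom P μ) (hittingTime B) M
      (2 * (startedFrom P μ).real (hitBy B T) + 4 * L) (20 * D) := by
  have hprob := hP.isProbabilityMeasure_startedFrom μ
  have hD0 : 0 < D := hL0.trans_le hL
  have hr0 : 0 ≤ (startedFrom P μ).real (hitBy B T) := measureReal_nonneg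
  have hsr : (0 : ℝ) < s := by rw [hs]; positivity
  have hs0 : 0 < s := by exact_mod_cast hsr
  have hθ : ∀ x, (P x).real (hitBy B s)ᶜ ≤ 1 - L * (1 - 7 * D) := fun x =>
    (hP.real_compl_hitBy_le hπ B hT hTs x).trans (by linarith)
  have hdecay := hP.real_compl_hitBy_le_pow μ B hθ
  have hp0 : 0 < L * (1 - 7 * D) := mul_pos hL0 (by linarith)
  have hp1 : L * (1 - 7 * D) ≤ L := by nlinarith
  have hp'0 : 0 < L * (1 + 5 * D) := mul_pos hL0 (by linarith)
  have hp'1 : L * (1 + 5 * D) ≤ 2 * L := by nlinarith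
  refine ⟨hM, by linarith, by linarith, by linarith, (measurable_hittingTime B).aemeasurable,
    ?_, ?_, ?_⟩
  · have hmean := lintegral_hittingTime_le (startedFrom P μ) B hs0 (by linarith) (by linarith)
      hdecay
    filter_upwards [ae_lt_top (measurable_hittingTime B)
      (ne_top_of_le_ne_top ENNReal.ofReal_ne_top hmean)] with ω hω using hω.ne
  · intro t ht
    -- If an early hit has probability above `1 / 2`, the coefficient 2 in `α` makes the lower bound
    -- negative.
    rcases le_or_gt ((startedFrom P μ).real (hitBy B T)) (1 / 2) with hr | hr
    swap
    · exact le_trans (mul_nonpos_of_nonpos_of_nonneg (by linarith) (Real.exp_pos _).le)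
        measureReal_nonneg
    have h1 := hP.pow_le_real_compl_hitBy μ B hκ hT hTs hup (by linarith) hr ⌈t / s⌉₊
    have h2 := exp_mul_le_one_sub_pow hp'0.le (by linarith) (div_pos ht hsr)
    have h3 : (startedFrom P μ).real (hitBy B (T + ⌈t / s⌉₊ * s))ᶜ ≤
        (startedFrom P μ).real {ω | ENNReal.ofReal t ≤ hittingTime B ω} := by
      refine measureReal_mono ?_
      rw [← setOf_lt_hittingTime]
      intro ω (hω : ((T + ⌈t / s⌉₊ * s : ℝ≥0) : ℝ≥0∞) < hittingTime B ω)
      refine le_trans ?_ hω.le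
      rw [← ENNReal.ofReal_coe_nnreal]
      refine ENNReal.ofReal_le_ofReal ?_
      have h4 := (div_le_iff₀ hsr).1 (Nat.le_ceil (t / s))
      push_cast
      linarith [T.coe_nonneg]
    refine le_trans ?_ (h1.trans h3)
    refine le_trans ?_ (mul_le_mul_of_nonneg_left h2 (by linarith))
    rw [← mul_assoc]
    refine mul_le_mul ?_ ?_ (Real.exp_pos _).le (mul_nonneg (by linarith) (by linarith))
    · nlinarith [mul_nonneg hr0 hp'0.le]
    · rw [Real.exp_le_exp]
      -- The constant 20 absorbs both `5 D` and the denominator's loss, using `L ≤ D ≤ 1 / 100`.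
      have hy : L * (1 + 5 * D) / (1 - L * (1 + 5 * D)) ≤ L / (1 - 20 * D) := by
        rw [div_le_div_iff₀ (by linarith) (by linarith)]
        have : (1 + 5 * D) * (1 - 20 * D) ≤ 1 - L * (1 + 5 * D) := by nlinarith
        nlinarith
      have h5 := mul_le_mul_of_nonneg_right hy (div_pos ht hsr).le
      have h6 : L / (1 - 20 * D) * (t / s) = t / ((1 - 20 * D) * M) := by
        have : 1 - 20 * D ≠ 0 := by linarith
        rw [hs]
        field_simp
      rw [h6] at h5
      rw [neg_div, neg_mul]
      linarith
  · intro t ht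
    -- `k = ⌈t / s⌉ - 1`, so that `k s < t` strictly: `t ≤ H` must imply `H > k s`.
    obtain ⟨k, hk⟩ := Nat.exists_eq_succ_of_ne_zero (Nat.ceil_pos.2 (div_pos ht hsr)).ne'
    have hk1 : (k : ℝ) * s < t := by
      have := Nat.ceil_lt_add_one (div_pos ht hsr).le
      rw [hk] at this
      push_cast at this
      rw [← lt_div_iff₀ hsr]
      linarith
    have hk2 : t / s ≤ k + 1 := by
      have := Nat.le_ceil (t / s)
      rw [hk] at this
      exact_mod_cast this
    have h1 : (startedFrom P μ).real {ω | ENNReal.ofReal t ≤ hittingTime B ω} ≤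
        (startedFrom P μ).real (hitBy B (k * s))ᶜ := by
      refine measureReal_mono ?_
      rw [← setOf_lt_hittingTime]
      intro ω (hω : ENNReal.ofReal t ≤ hittingTime B ω)
      refine lt_of_lt_of_le ?_ hω
      rw [← ENNReal.ofReal_coe_nnreal]
      exact (ENNReal.ofReal_lt_ofReal_iff ht).2 (by push_cast; exact hk1)
    refine (h1.trans (hdecay k)).trans
      ((one_sub_pow_le_exp_mul hp0.le (by linarith) hk2).trans ?_)
    refine mul_le_mul (by linarith) ?_ (Real.exp_pos _).le (by linarith)
    rw [Real.exp_le_exp]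
    have hy : L / (1 + 20 * D) ≤ L * (1 - 7 * D) := by
      rw [div_le_iff₀ (by linarith)]
      have : 1 ≤ (1 - 7 * D) * (1 + 20 * D) := by nlinarith
      nlinarith
    have h5 := mul_le_mul_of_nonneg_right hy (div_pos ht hsr).le
    have h6 : L / (1 + 20 * D) * (t / s) = t / ((1 + 20 * D) * M) := by
      rw [hs]
      field_simp
    rw [h6] at h5
    rw [neg_div, neg_mul]
    linarith

end NearExponential

end RareEvents

end

/-! ### The union of the sets, and the theorem. -/

theorem mainTheorem6 :
    ∃ C > (0 : ℝ), ∃ c > (0 : ℝ),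
      ∀ (V : Type*) [Fintype V] (q : V → V → ℝ) (P : V → Measure (RareEvents.Path V))
        (π : PMF V) (l : ℕ) (A : Fin l → Set V) (m : ℝ≥0∞) (δ ε : ℝ),
        (∀ x y, x ≠ y → 0 ≤ q x y) →
        RareEvents.IsMarkovChain q P →
        RareEvents.IsMixing P π →
        (∀ i, (A i).Nonempty) →
        0 < π.toOuterMeasure (⋃ i, A i) →
        (∀ i, ∫⁻ ω, RareEvents.hittingTime (A i) ω ∂(RareEvents.startedFrom P π) = m) →
        0 < δ → δ < 1 / 5 →
        0 < ε → ε < δ / (2 * l) →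
        (∀ i, (RareEvents.startedFrom P π).real
            {ω | RareEvents.hittingTime (A i) ω ≤ RareEvents.mixingTime P π (δ * ε / 2)}
          ≤ δ * ε / 2) →
        δ + RareEvents.pairCorrelation P π A m ε ≤ c →
        ∀ μ : PMF V, ∃ a b : ℝ,
          |a| ≤ C * (l * ε) ∧
          |b| ≤ C * (δ + RareEvents.pairCorrelation P π A m ε) ∧
          RareEvents.IsNearExp (RareEvents.startedFrom P μ)
            (RareEvents.hittingTime (⋃ i, A i))
            (m.toReal / l)
            (2 * (RareEvents.startedFrom P μ).real
                {ω | RareEvents.hittingTime (⋃ i, A i) ω ≤ RareEvents.mixingTime P π (δ * ε)}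
              + a)
            b := by
  refine ⟨20, by norm_num, 1 / 100, by norm_num, ?_⟩
  intro V _ q P π l A m δ ε _ hP hπ _ hA hm hδ0 _ hε0 hεδ hhit hc μ
  have hprob := hP.isProbabilityMeasure_startedFrom π
  -- One charged `A i` suffices: its mean is finite, and the means are equal. It also shows `l ≥ 1`.
  obtain ⟨i₀, x₀, hx₀, hπx₀⟩ : ∃ i, ∃ x ∈ A i, π x ≠ 0 := by
    by_contra! h
    refine hA.ne' ((PMF.toOuterMeasure_apply_eq_zero_iff _ _).2 (Set.disjoint_left.2 ?_))
    intro x hx hxA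
    obtain ⟨i, hi⟩ := Set.mem_iUnion.1 hxA
    exact (π.mem_support_iff x).1 hx (h i x hi)
  have hl : (1 : ℝ) ≤ l := by exact_mod_cast i₀.pos
  have hlε : l * ε ≤ δ / 2 := by
    rw [lt_div_iff₀ (by linarith)] at hεδ
    linarith
  have hεle : ε ≤ l * ε := le_mul_of_one_le_left hε0.le hl
  have hlε0 : 0 < l * ε := hε0.trans_le hεle
  have hmtop : m ≠ ∞ := hm i₀ ▸ hπ.lintegral_hittingTime_ne_top hP π hx₀ hπx₀
  lift m to ℝ≥0 using hmtop
  have hmul : ENNReal.ofReal ε * (m : ℝ≥0∞) = ((ε.toNNReal * m : ℝ≥0) : ℝ≥0∞) := by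
    rw [ENNReal.coe_mul]; rfl
  have hsum : ∑ p : Fin l × Fin l with p.1 < p.2, (RareEvents.startedFrom P π).real
      (RareEvents.hitBy (A p.1) (ε.toNNReal * m) ∩ RareEvents.hitBy (A p.2) (ε.toNNReal * m)) =
      l * ε * RareEvents.pairCorrelation P π A m ε := by
    rw [RareEvents.pairCorrelation, ← mul_assoc, mul_one_div_cancel hlε0.ne', one_mul]
    refine Finset.sum_congr rfl fun p _ => ?_
    rw [hmul, ← RareEvents.setOf_hittingTime_le, ← RareEvents.setOf_hittingTime_le]
    rfl
  have hξ0 : 0 ≤ RareEvents.pairCorrelation P π A m ε :=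
    mul_nonneg (by positivity) (Finset.sum_nonneg fun _ _ => measureReal_nonneg)
  obtain ⟨ξ, hξ⟩ : ∃ ξ, ξ = RareEvents.pairCorrelation P π A m ε := ⟨_, rfl⟩
  rw [← hξ] at hsum hξ0 hc ⊢
  have hδε : 0 < δ * ε := mul_pos hδ0 hε0
  have hδε1 : δ * ε < 1 := by nlinarith
  have hT₁ := hπ.mixedAt_mixingTime hP (half_pos hδε) (by linarith)
  have hT₂ := hπ.mixedAt_mixingTime hP hδε hδε1
  have hT₂₁ := hπ.mixingTime_anti (half_pos hδε) (half_le_self hδε.le) hδε1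
  simp only [RareEvents.setOf_hittingTime_le] at hhit ⊢
  generalize RareEvents.mixingTime P π (δ * ε / 2) = T₁ at *
  generalize RareEvents.mixingTime P π (δ * ε) = T₂ at *
  have hm0 : 0 < m := by
    refine pos_iff_ne_zero.2 fun h0 => ?_
    have h1 := RareEvents.real_hitBy_zero_of_lintegral_eq_zero
      ((hm i₀).trans (by rw [h0]; rfl))
    have h2 := hP.real_hitBy_mono π (A i₀) (zero_le (a := T₁))
    linarith [hhit i₀]
  have hsr : ((ε.toNNReal * m : ℝ≥0) : ℝ) = ε * m := by
    rw [NNReal.coe_mul, Real.coe_toNNReal _ hε0.le]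
  generalize ε.toNNReal * m = s at *
  have hT₁s : T₁ ≤ s := by
    have := hP.le_mul_mean_hittingTime hπ.stationary hδ0 (by linarith) hε0 (by linarith) (hm i₀)
      (hhit i₀)
    rw [← hsr] at this
    exact_mod_cast this
  have hone := fun i => hP.real_hitBy_mul_mean_mem_Icc hπ.stationary hδ0 (by linarith) hε0
    (by linarith) hm0 (hm i) hT₁ hT₁s hsr (hhit i)
  have hup : (RareEvents.startedFrom P π).real (RareEvents.hitBy (⋃ i, A i) s) ≤
      l * ε * (1 + δ) := by
    rw [RareEvents.hitBy_iUnion]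
    refine (measureReal_iUnion_fintype_le _).trans
      ((Finset.sum_le_sum fun i _ => (hone i).2).trans (le_of_eq ?_))
    simp [mul_assoc]
  have hlow : l * ε * (1 - 5 * δ - ξ) ≤
      (RareEvents.startedFrom P π).real (RareEvents.hitBy (⋃ i, A i) s) := by
    rw [RareEvents.hitBy_iUnion]
    have h1 := RareEvents.sum_real_sub_sum_real_inter_le (RareEvents.startedFrom P π)
      fun i => RareEvents.measurableSet_hitBy (A i) s
    have h2 := Finset.sum_le_sum fun i (_ : i ∈ Finset.univ) => (hone i).1
    rw [hsum] at h1
    rw [Finset.sum_const, Finset.card_univ, Fintype.card_fin, nsmul_eq_mul] at h2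
    linarith
  -- The survival estimates for the union use mixing level `δ ε`; since `T₂ ≤ T₁`, the hypothesis on
  -- each `A i` at `T₁` suffices.
  have hρ : (RareEvents.startedFrom P π).real (RareEvents.hitBy (⋃ i, A i) T₂) ≤
      l * ε * δ / 2 := by
    refine (hP.real_hitBy_mono π _ hT₂₁).trans ?_
    rw [RareEvents.hitBy_iUnion]
    refine (measureReal_iUnion_fintype_le _).trans
      ((Finset.sum_le_sum fun i _ => hhit i).trans (le_of_eq ?_))
    rw [Finset.sum_const, Finset.card_univ, Fintype.card_fin, nsmul_eq_mul]
    ring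
  have hκ : δ * ε ≤ l * ε * δ := by nlinarith
  have hlξ : 0 ≤ l * ε * ξ := by positivity
  have hlδ : 0 ≤ l * ε * δ := by positivity
  -- These are `4 L` and `20 D` for `L = l ε`, `D = δ + ξ`, `M = m / l`, so that `s = ε m = L M`.
  refine ⟨4 * (l * ε), 20 * (δ + ξ), ?_, ?_, ?_⟩
  · rw [abs_of_pos (by linarith)]
    linarith
  · rw [abs_of_pos (by linarith)]
  · refine hP.isNearExp_hittingTime hπ.stationary hδε.le hT₂ (hT₂₁.trans hT₁s) hlε0
      (by linarith) hc (div_pos (by exact_mod_cast hm0) (by linarith)) ?_ ?_ ?_ μ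
    · rw [hsr, ENNReal.coe_toReal]
      field_simp
    · nlinarith
    · nlinarith
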